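/- Let $E=\mathbb R$ or $E=\mathbb R_+=[0,\infty)$ and $\alpha>0$. A sup-measure on $E$ is a map $m$ from the open subsets of $E$ to $[0,\infty]$ with $m(\emptyset)=0$ and $m(\bigcup_i G_i)=\sup_i m(G_i)$ for all families of open sets; it is extended to all $A\subset E$ by $m(A)=\inf\{m(G): G\supset A \text{ open}\}$. A random sup-measure is a random element of the space of sup-measures with the Borel $\sigma$-algebra of the sup-vague topology. A random sup-measure $\mathcal M$ on $E$ is called Choquet $\alpha$-Fréchet with extremal coefficient functional $\theta$ (a finite function of the compact subsets of $E$) if \[ \mathcal M(\cdot)\stackrel{d}{=}\sup_{\ell\in\mathbb N}\Gamma_\ell^{-1/\alpha}\,\mathbf 1_{\{R_\ell\cap\,\cdot\,\neq\emptyset\}}, \] where $\{(\Gamma_\ell,R_\ell)\}_{\ell\in\mathbb N}$ is a measurable enumeration of the points of a Poisson point process on $(0,\infty)\times\mathcal F(E)$ with intensity $dx\,d\nu$; here $\mathcal F(E)$ is the space of closed subsets of $E$ with the Fell topology, and $\nu$ is the measure on $\mathcal F(E)$ with $\nu(\{\emptyset\})=0$ and $\nu(\{F:F\cap K\ne\emptyset\})=\theta(K)$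 for all compact $K\subset E$. Let $\mathbb M(t)=\mathcal M([0,t])$, $t\ge 0$, be the extremal process of such an $\mathcal M$. (i) For all $d\in\mathbb N$, $0<t_1<\cdots<t_d$ and $x_1,\dots,x_d\in(0,\infty)$, \[ \mathbb P\big(\mathbb M(t_k)\le x_k,\ k=1,\dots,d\big)=\exp\Big(-\sum_{k=1}^d a_k\,\theta([0,t_k])\Big), \] where \[ a_k=\frac1{\big(\min_{k\le j\le d}x_j\big)^{\alpha}}-\frac1{\big(\min_{k+1\le j\le d}x_j\big)^{\alpha}},\quad k=1,\dots,d-1,\qquad a_d=\frac1{x_d^{\alpha}}. \] (ii) If in addition $\mathcal M$ is $H$-self-similar with $H>0$, i.e. $\mathcal M(\lambda\,\cdot)\stackrel{d}{=}\lambda^H\mathcal M(\cdot)$ for all $\lambda>0$, then \[ \{\mathbb M(t)\}_{t\ge0}\stackrel{d}{=}\theta([0,1])^{1/\alpha}\,\{\mathbb M_\alpha(t^{\alpha H})\}_{t\ge 0}, \] where $\mathbb M_\alpha(t)=\sup_{\ell}\Gamma_\ell^{-1/\alpha}\mathbf 1_{\{U_\ell\le t\}}$, $t\ge0$, is the standard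 $\alpha$-Fréchet extremal process, $\{(\Gamma_\ell,U_\ell)\}_{\ell\in\mathbb N}$ being an enumeration of the points of a Poisson point process on $(0,\infty)\times[0,\infty)$ with intensity $dx\,du$. -/

import Mathlib

open Set MeasureTheory ProbabilityTheory TopologicalSpace
open scoped ENNReal NNReal

noncomputable section

/-! ### Closed sets with the Fell topology -/

/-- The closed sets hitting `A`. -/
def hitSet {E : Type*} [TopologicalSpace E] (A : Set E) : Set (Closeds E) :=
  {F | ((F : Set E) ∩ A).Nonempty}

/-- The Fell (hit-and-miss) topology on the closed subsets of `E`. -/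
@[reducible] def fellTopology (E : Type*) [TopologicalSpace E] : TopologicalSpace (Closeds E) :=
  TopologicalSpace.generateFrom
    ({S | ∃ G : Set E, IsOpen G ∧ S = hitSet G} ∪ {S | ∃ K : Set E, IsCompact K ∧ S = (hitSet K)ᶜ})

/-- The Borel σ-algebra of the Fell topology. -/
instance fellMeasurableSpace (E : Type*) [TopologicalSpace E] : MeasurableSpace (Closeds E) :=
  @borel _ (fellTopology E)

/-! ### Sup-measures -/

/-- A sup-measure on `E`: a set function on the open sets, with values in `[0, ∞]`, that
vanishes at the empty set and turns arbitrary unions into suprema. -/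
structure SupMeasure (E : Type*) [TopologicalSpace E] where
  toFun : Opens E → ℝ≥0∞
  map_empty : toFun ⊥ = 0
  map_sSup : ∀ S : Set (Opens E), toFun (sSup S) = ⨆ G ∈ S, toFun G

namespace SupMeasure

variable {E : Type*} [TopologicalSpace E]

/-- The canonical extension of a sup-measure to all subsets of `E`. -/
def extend (m : SupMeasure E) (A : Set E) : ℝ≥0∞ :=
  ⨅ (G : Opens E) (_ : A ⊆ (G : Set E)), m.toFun G

theorem toFun_mono (m : SupMeasure E) {G G' : Opens E} (h : G ≤ G') :
    m.toFun G ≤ m.toFun G' := by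
  have h1 := m.map_sSup {G, G'}
  have h2 : sSup {G, G'} = G' :=
    le_antisymm (sSup_le fun x hx => by rcases hx with rfl | rfl <;> [exact h; exact le_rfl])
      (le_sSup (by simp))
  rw [h2] at h1
  rw [h1]
  exact le_iSup₂_of_le G (by simp) le_rfl

theorem extend_coe (m : SupMeasure E) (G : Opens E) : m.extend (G : Set E) = m.toFun G :=
  le_antisymm (iInf₂_le G (Set.Subset.refl _)) (le_iInf₂ fun _ h => m.toFun_mono h)

theorem extend_mono (m : SupMeasure E) {A B : Set E} (h : A ⊆ B) : m.extend A ≤ m.extend B :=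
  le_iInf₂ fun G hG => iInf₂_le G (h.trans hG)

/-- The canonical extension turns arbitrary unions into suprema. -/
theorem extend_biUnion (m : SupMeasure E) {ι : Type*} (S : Set ι) (A : ι → Set E) :
    m.extend (⋃ i ∈ S, A i) = ⨆ i ∈ S, m.extend (A i) := by
  apply le_antisymm
  · refine le_of_forall_gt_imp_ge_of_dense fun y hy => ?_
    have h1 : ∀ i ∈ S, ∃ G : Opens E, A i ⊆ (G : Set E) ∧ m.toFun G < y := by
      intro i hi
      have h2 : m.extend (A i) < y := lt_of_le_of_lt (le_iSup₂_of_le i hi le_rfl) hy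
      simpa [extend, iInf_lt_iff] using h2
    choose! G hG1 hG2 using h1
    refine (iInf₂_le (sSup (G '' S)) ?_).trans ?_
    · refine iUnion₂_subset fun i hi => (hG1 i hi).trans ?_
      exact SetLike.coe_subset_coe.2 (le_sSup (mem_image_of_mem G hi))
    · rw [m.map_sSup]
      refine iSup₂_le ?_
      rintro _ ⟨i, hi, rfl⟩
      exact (hG2 i hi).le
  · exact iSup₂_le fun i hi => m.extend_mono (subset_biUnion_of_mem (u := A) hi)

/-- The sup-vague topology: `m ↦ m K` is upper semicontinuous for compact `K` and
`m ↦ m G` is lower semicontinuous for open `G`. -/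
instance supVagueTopology : TopologicalSpace (SupMeasure E) :=
  TopologicalSpace.generateFrom
    ({S | ∃ (K : Set E) (x : ℝ≥0∞), IsCompact K ∧ S = {m | m.extend K < x}} ∪
      {S | ∃ (G : Opens E) (x : ℝ≥0∞), S = {m | x < m.toFun G}})

/-- The Borel σ-algebra of the sup-vague topology. A random sup-measure is a measurable map
into `SupMeasure E`. -/
instance : MeasurableSpace (SupMeasure E) := borel _

/-- The sup-measure `c m(·)`. -/
def scale (c : ℝ≥0∞) (m : SupMeasure E) : SupMeasure E where
  toFun G := c * m.toFun G
  map_empty := by simp [m.map_empty]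
  map_sSup S := by simp [m.map_sSup, ENNReal.mul_iSup]

/-- The sup-measure `G ↦ sup_ℓ w ℓ 1{F ℓ ∩ G ≠ ∅}`, from weights `w ℓ` and closed sets `F ℓ`. -/
def ofPoints (w : ℕ → ℝ≥0∞) (F : ℕ → Closeds E) : SupMeasure E where
  toFun G := ⨆ ℓ, (hitSet (G : Set E)).indicator (fun _ => w ℓ) (F ℓ)
  map_empty := by simp [hitSet]
  map_sSup S := by
    classical
    apply le_antisymm
    · refine iSup_le fun ℓ => ?_
      by_cases h : F ℓ ∈ hitSet ((sSup S : Opens E) : Set E)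
      · obtain ⟨x, hx, hxS⟩ := h
        obtain ⟨G, hG, hxG⟩ := Opens.mem_sSup.1 hxS
        have hF : F ℓ ∈ hitSet (G : Set E) := ⟨x, hx, hxG⟩
        refine le_trans ?_ (le_iSup₂_of_le G hG (le_iSup_of_le ℓ le_rfl))
        rw [indicator_of_mem hF]
        exact indicator_le_self _ _ _
      · rw [indicator_of_notMem h]
        exact zero_le
    · refine iSup₂_le fun G hG => iSup_mono fun ℓ => ?_
      refine indicator_le_indicator_of_subset ?_ (fun _ => zero_le) _
      rintro C ⟨x, hx, hxG⟩
      exact ⟨x, hx, Opens.mem_sSup.2 ⟨G, hG, hxG⟩⟩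

/-- The sup-measure `m(c ·)`, where `c A = {c y : y ∈ A}`, on a subset `E` of the real line. -/
def dilate {E : Set ℝ} (c : ℝ≥0) (m : SupMeasure E) : SupMeasure E where
  toFun G := m.extend {x | ∃ y ∈ G, (x : ℝ) = c * y}
  map_empty := by
    have h := m.extend_coe ⊥
    simpa [m.map_empty] using h
  map_sSup S := by
    rw [← m.extend_biUnion]
    congr 1
    ext x
    simp only [mem_ofPred_eq, mem_iUnion, Opens.mem_sSup, exists_prop]
    tauto

end SupMeasure

/-! ### Poisson point processes -/

/-- The number of points of the sequence `X` lying in `B`. -/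
def countIn {Ω S : Type*} (X : ℕ → Ω → S) (B : Set S) (ω : Ω) : ℝ≥0∞ :=
  ∑' ℓ, B.indicator (fun _ => 1) (X ℓ ω)

/-- `X` is a measurable enumeration of the points of a Poisson point process with intensity `μ`:
the number of points in `B` is Poisson with mean `μ B` (it is `∞` almost surely if `μ B = ∞`), and
the numbers of points in disjoint sets are independent. -/
structure IsPoissonEnumeration {Ω S : Type*} [MeasurableSpace Ω] [MeasurableSpace S]
    (X : ℕ → Ω → S) (μ : Measure S) (P : Measure Ω) : Prop where
  measurable : ∀ ℓ, Measurable (X ℓ)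
  poisson : ∀ B : Set S, MeasurableSet B → μ B ≠ ∞ → ∀ n : ℕ,
    P {ω | countIn X B ω = n} =
      ENNReal.ofReal (Real.exp (-(μ B).toReal) * (μ B).toReal ^ n / n.factorial)
  infinite : ∀ B : Set S, MeasurableSet B → μ B = ∞ → ∀ᵐ ω ∂P, countIn X B ω = ∞
  indep : ∀ (n : ℕ) (B : Fin n → Set S), (∀ i, MeasurableSet (B i)) →
    Pairwise (fun i j => Disjoint (B i) (B j)) → iIndepFun (fun i => countIn X (B i)) P

/-! ### Choquet random sup-measures, self-similarity, extremal processes -/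

/-- The weight `1 / Γ ^ (1 / α)`. -/
def frechetWeight (α Γ : ℝ) : ℝ≥0∞ := ENNReal.ofReal (1 / Γ ^ (1 / α))

/-- `M` is a Choquet `α`-Fréchet random sup-measure with extremal coefficient functional `θ`:
`M` has the law of `sup_ℓ Γ_ℓ^(-1/α) 1{R_ℓ ∩ · ≠ ∅}`, where the `(Γ_ℓ, R_ℓ)` are the points of
a Poisson point process on `(0, ∞) × 𝓕(E)` with intensity `dx dν`, and `ν` is the measure on the
nonempty closed sets with `ν {F | F ∩ K ≠ ∅} = θ K < ∞` for compact `K`. Only the values of `θ`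
at compact sets matter. -/
def IsChoquetFrechet {E Ω : Type*} [TopologicalSpace E] [MeasurableSpace Ω]
    (α : ℝ) (θ : Set E → ℝ≥0) (M : Ω → SupMeasure E) (P : Measure Ω) : Prop :=
  ∃ ν : Measure (Closeds E), ν {⊥} = 0 ∧ (∀ K : Set E, IsCompact K → ν (hitSet K) = θ K) ∧
    ∃ (Ω' : Type) (_ : MeasurableSpace Ω') (P' : Measure Ω') (Γ : ℕ → Ω' → ℝ)
      (R : ℕ → Ω' → Closeds E),
      IsProbabilityMeasure P' ∧
      IsPoissonEnumeration (fun ℓ ω => (Γ ℓ ω, R ℓ ω))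
        (((volume : Measure ℝ).restrict (Ioi 0)).prod ν) P' ∧
      IdentDistrib M
        (fun ω => SupMeasure.ofPoints (fun ℓ => frechetWeight α (Γ ℓ ω)) (fun ℓ => R ℓ ω)) P P'

/-- `M` is `H`-self-similar: `M(c ·)` and `c ^ H M(·)` have the same law, for all `c > 0`. -/
def IsSelfSimilar {E : Set ℝ} {Ω : Type*} [MeasurableSpace Ω]
    (H : ℝ) (M : Ω → SupMeasure E) (P : Measure Ω) : Prop :=
  ∀ c : ℝ≥0, 0 < c →
    IdentDistrib (fun ω => (M ω).dilate c) (fun ω => (M ω).scale ((c ^ H : ℝ≥0) : ℝ≥0∞)) P P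

/-- The interval `[0, t]`, as a subset of `E`. -/
def initialInterval (E : Set ℝ) (t : ℝ) : Set E := {x | (x : ℝ) ∈ Icc 0 t}

/-- The extremal process `t ↦ M([0, t])` of a random sup-measure on `E`. -/
def extremalProcess {E : Set ℝ} {Ω : Type*} (M : Ω → SupMeasure E) (ω : Ω) (t : ℝ≥0) : ℝ≥0∞ :=
  (M ω).extend (initialInterval E t)

/-- `Z` is a standard `α`-Fréchet extremal process: `Z(t) = sup_ℓ Γ_ℓ^(-1/α) 1{U_ℓ ≤ t}`, where
the `(Γ_ℓ, U_ℓ)` are the points of a Poisson point process on `(0, ∞) × [0, ∞)` with intensity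
`dx du`. -/
def IsStandardExtremalProcess {Ω : Type*} [MeasurableSpace Ω] (α : ℝ)
    (Z : Ω → ℝ≥0 → ℝ≥0∞) (P : Measure Ω) : Prop :=
  ∃ Γ U : ℕ → Ω → ℝ,
    IsPoissonEnumeration (fun ℓ ω => (Γ ℓ ω, U ℓ ω))
      (((volume : Measure ℝ).restrict (Ioi 0)).prod ((volume : Measure ℝ).restrict (Ici 0))) P ∧
    ∀ ω t, Z ω t = ⨆ ℓ, (Icc (0 : ℝ) t).indicator (fun _ => frechetWeight α (Γ ℓ ω)) (U ℓ ω)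

/-- The minimum of `x j` over `j ≥ k`. -/
def tailMin {d : ℕ} (x : Fin d → ℝ) (k : Fin d) : ℝ :=
  (Finset.Ici k).inf' ⟨k, Finset.mem_Ici.2 le_rfl⟩ x

/-- The weights `a_k = 1 / (min_{j ≥ k} x_j) ^ α - 1 / (min_{j ≥ k + 1} x_j) ^ α` for `k` not the
last index, and `a_k = 1 / x_k ^ α` for the last one. -/
def extremalWeight (α : ℝ) {d : ℕ} (x : Fin d → ℝ) (k : Fin d) : ℝ :=
  if h : (k : ℕ) + 1 < d then 1 / tailMin x k ^ α - 1 / tailMin x ⟨k + 1, h⟩ ^ α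
  else 1 / x k ^ α

end

/-! ### Measurability -/

/-! The event in (i) is a void event. `M([0,t_k]) ≤ x_k` for all `k` says that no Poisson point `(Γ,
R)` satisfies `Γ < x_k^(-α)` and `R ∩ [0,t_k] ≠ ∅` for some `k`. Since the intervals are nested,
this forbidden region is the disjoint union over `k` of strips `[s_{k+1}, s_k)` in `Γ` times the
sets hitting `[0,t_k]`, where `s_k = max_{j ≥ k} x_j^(-α)` and `s` is `0` past the last index. The
strips have length `a_k`, so the region has intensity `∑ a_k θ([0,t_k])`
(`exists_lt_iff_exists_mem_Ico`, `prod_iUnion_Ico_tailLevel`, `measure_forall_iSup_le`). The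
sup-measure is given on open sets only, so its value at a compact set must first be identified with
a supremum over the points hitting that set (`extend_ofPoints`).

For (ii), comparing one-dimensional laws under self-similarity gives `θ([0,t]) = θ([0,1]) t^(αH)`.
The same void computation with Lebesgue measure in place of `ν` gives the standard process the same
joint distribution functions, and these determine the law of the process. -/

lemma measurableSet_hitSet {E : Type*} [TopologicalSpace E] {K : Set E} (hK : IsCompact K) :
    MeasurableSet (hitSet K) := by
  let : TopologicalSpace (Closeds E) := fellTopology E
  have : BorelSpace (Closeds E) := ⟨rfl⟩
  have h : IsOpen (hitSet K)ᶜ := isOpen_generateFrom_of_mem (Or.inr ⟨K, hK, rfl⟩)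
  simpa using h.measurableSet.compl

lemma SupMeasure.measurable_extend {E : Type*} [TopologicalSpace E] {K : Set E}
    (hK : IsCompact K) : Measurable fun m : SupMeasure E => m.extend K := by
  have : BorelSpace (SupMeasure E) := ⟨rfl⟩
  refine measurable_of_Iio fun x => ?_
  have h : IsOpen {m : SupMeasure E | m.extend K < x} :=
    isOpen_generateFrom_of_mem (Or.inl ⟨K, x, hK, rfl⟩)
  exact h.measurableSet

/-! ### Poisson enumerations -/

namespace IsPoissonEnumeration

variable {Ω S : Type*} [MeasurableSpace Ω] [MeasurableSpace S] {X : ℕ → Ω → S} {μ : Measure S}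
  {P : Measure Ω}

lemma measure_forall_notMem (h : IsPoissonEnumeration X μ P) {B : Set S} (hB : MeasurableSet B)
    (hμ : μ B ≠ ∞) :
    P {ω | ∀ ℓ, X ℓ ω ∉ B} = ENNReal.ofReal (Real.exp (-(μ B).toReal)) := by
  have h0 := h.poisson B hB hμ 0
  simpa [countIn] using h0

lemma measurableSet_forall_notMem (h : IsPoissonEnumeration X μ P) {B : Set S}
    (hB : MeasurableSet B) : MeasurableSet {ω | ∀ ℓ, X ℓ ω ∉ B} := by
  rw [Set.ofPred_forall]
  exact MeasurableSet.iInter fun ℓ => (h.measurable ℓ hB).compl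

lemma measurable_countIn (h : IsPoissonEnumeration X μ P) {B : Set S}
    (hB : MeasurableSet B) : Measurable (countIn X B) :=
  Measurable.tsum fun ℓ => (measurable_const.indicator hB).comp (h.measurable ℓ)

lemma ae_forall_notMem [IsProbabilityMeasure P] (h : IsPoissonEnumeration X μ P) {B : Set S}
    (hB : MeasurableSet B) (hμ : μ B = 0) : ∀ᵐ ω ∂P, ∀ ℓ, X ℓ ω ∉ B := by
  have h1 := h.measure_forall_notMem hB (by simp [hμ])
  exact (mem_ae_iff_prob_eq_one (h.measurableSet_forall_notMem hB)).2 (by simpa [hμ] using h1)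

/-- The Poisson masses at the natural numbers add up to one, which leaves no mass for an infinite
count. -/
lemma ae_finite [IsProbabilityMeasure P] (h : IsPoissonEnumeration X μ P) {B : Set S}
    (hB : MeasurableSet B) (hμ : μ B ≠ ∞) : ∀ᵐ ω ∂P, {ℓ | X ℓ ω ∈ B}.Finite := by
  have hm := h.measurable_countIn hB
  have h1 : P (⋃ n : ℕ, {ω | countIn X B ω = n}) = 1 := by
    rw [measure_iUnion]
    · simp_rw [h.poisson B hB hμ]
      have h2 := hasSum_one_poissonMeasure (μ B).toNNReal
      rw [← ENNReal.ofReal_one, ← h2.tsum_eq, ENNReal.ofReal_tsum_of_nonneg _ h2.summable]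
      · rfl
      · intro n; positivity
    · intro i j hij
      refine Set.disjoint_left.2 fun ω hi hj => hij ?_
      simp only [Set.mem_ofPred_eq] at hi hj
      exact_mod_cast hi.symm.trans hj
    · exact fun n => hm (measurableSet_singleton _)
  have h3 : ∀ᵐ ω ∂P, ω ∈ ⋃ n : ℕ, {ω | countIn X B ω = n} := by
    rw [← mem_ae_iff_prob_eq_one] at h1
    · exact h1
    · exact MeasurableSet.iUnion fun n => hm (measurableSet_singleton _)
  filter_upwards [h3] with ω hω
  obtain ⟨n, hn⟩ := Set.mem_iUnion.1 hω
  have h4 : countIn X B ω ≠ ∞ := by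
    rw [show countIn X B ω = n from hn]; exact ENNReal.natCast_ne_top n
  refine (ENNReal.finite_const_le_of_tsum_ne_top h4 one_ne_zero).subset fun ℓ hℓ => ?_
  have hℓ : X ℓ ω ∈ B := hℓ
  simp [hℓ]

end IsPoissonEnumeration

/-! ### Weights -/

/-- The factor `c` lets one computation serve both parts: `c = 1` for the Choquet sup-measure, `c =
θ([0,1])` for the rescaled standard process. -/
lemma mul_frechetWeight_le_iff {α : ℝ} (hα : 0 < α) {γ : ℝ} (hγ : 0 < γ) (c : ℝ≥0) {x : ℝ}
    (hx : 0 < x) :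
    ((c ^ (1 / α) : ℝ≥0) : ℝ≥0∞) * frechetWeight α γ ≤ ENNReal.ofReal x ↔ c / x ^ α ≤ γ := by
  have h1 : ((c ^ (1 / α) : ℝ≥0) : ℝ≥0∞) * frechetWeight α γ =
      ENNReal.ofReal ((c / γ : ℝ) ^ (1 / α)) := by
    rw [frechetWeight, ← ENNReal.ofReal_coe_nnreal, ← ENNReal.ofReal_mul (by positivity),
      Real.div_rpow c.coe_nonneg hγ.le, NNReal.coe_rpow, mul_one_div]
  rw [h1, ENNReal.ofReal_le_ofReal_iff hx.le, one_div,
    Real.rpow_inv_le_iff_of_pos (by positivity) hx.le hα, div_le_iff₀ hγ,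
    div_le_iff₀ (by positivity), mul_comm]

/-- The decreasing sequence `c / (tailMin x k) ^ α`, continued by `0`. -/
noncomputable def tailLevel (α c : ℝ) {d : ℕ} (x : Fin d → ℝ) (n : ℕ) : ℝ :=
  if h : n < d then c / tailMin x ⟨n, h⟩ ^ α else 0

section tailLevel

variable {α c : ℝ} {d : ℕ} {x : Fin d → ℝ}

lemma exists_tailMin_eq (x : Fin d → ℝ) (k : Fin d) : ∃ j, k ≤ j ∧ tailMin x k = x j := by
  obtain ⟨j, hj, h⟩ := Finset.exists_mem_eq_inf' (s := Finset.Ici k)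
    ⟨k, Finset.mem_Ici.2 le_rfl⟩ x
  exact ⟨j, Finset.mem_Ici.1 hj, h⟩

lemma tailMin_pos (hx : ∀ k, 0 < x k) (k : Fin d) : 0 < tailMin x k := by
  obtain ⟨j, -, h⟩ := exists_tailMin_eq x k
  exact h ▸ hx j

lemma tailMin_le {j k : Fin d} (h : k ≤ j) : tailMin x k ≤ x j :=
  Finset.inf'_le _ (Finset.mem_Ici.2 h)

lemma tailLevel_nonneg (hc : 0 ≤ c) (hx : ∀ k, 0 < x k) (n : ℕ) : 0 ≤ tailLevel α c x n := by
  unfold tailLevel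
  split_ifs with h
  · have := tailMin_pos hx ⟨n, h⟩
    positivity
  · exact le_rfl

lemma le_tailLevel (hα : 0 < α) (hc : 0 ≤ c) (hx : ∀ k, 0 < x k) {n : ℕ} {j : Fin d}
    (h : n ≤ j) : c / x j ^ α ≤ tailLevel α c x n := by
  have hn : n < d := h.trans_lt j.2
  have h0 := tailMin_pos hx ⟨n, hn⟩
  rw [tailLevel, dif_pos hn]
  gcongr
  exact tailMin_le h

lemma exists_tailLevel_eq (α c : ℝ) (x : Fin d → ℝ) {n : ℕ} (hn : n < d) :
    ∃ j : Fin d, n ≤ j ∧ tailLevel α c x n = c / x j ^ α := by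
  obtain ⟨j, hj, h⟩ := exists_tailMin_eq x ⟨n, hn⟩
  exact ⟨j, hj, by rw [tailLevel, dif_pos hn, h]⟩

lemma antitone_tailLevel (hα : 0 < α) (hc : 0 ≤ c) (hx : ∀ k, 0 < x k) :
    Antitone (tailLevel α c x) := by
  intro n m hnm
  by_cases hm : m < d
  · obtain ⟨j, hj, h⟩ := exists_tailLevel_eq α c x hm
    rw [h]
    exact le_tailLevel hα hc hx (hnm.trans hj)
  · rw [tailLevel, dif_neg hm]
    exact tailLevel_nonneg hc hx n

lemma tailLevel_sub_tailLevel (α c : ℝ) (x : Fin d → ℝ) (k : Fin d) :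
    tailLevel α c x k - tailLevel α c x (k + 1) = c * extremalWeight α x k := by
  unfold extremalWeight
  split_ifs with h
  · rw [tailLevel, dif_pos k.2, tailLevel, dif_pos h]
    simp only [Fin.eta]
    ring
  · obtain ⟨j, hj, hx⟩ := exists_tailMin_eq x k
    have hjk : j = k := le_antisymm (Fin.le_def.2 (by omega)) hj
    subst hjk
    rw [tailLevel, dif_pos j.2, tailLevel, dif_neg h]
    simp only [Fin.eta, hx]
    ring

/-- Among the indices `j` with `γ < c / x j ^ α`, take the largest: `A` is monotone, so `y` stays in
`A j`, and maximality puts `γ` at or above the next level. This turns an overlapping union into a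
disjoint one. -/
lemma exists_lt_iff_exists_mem_Ico (hα : 0 < α) (hc : 0 ≤ c) (hx : ∀ k, 0 < x k) {S : Type*}
    {A : Fin d → Set S} (hA : Monotone A) {γ : ℝ} (hγ : 0 < γ) (y : S) :
    (∃ k, y ∈ A k ∧ γ < c / x k ^ α) ↔
      ∃ k : Fin d, γ ∈ Ico (tailLevel α c x (k + 1)) (tailLevel α c x k) ∧ y ∈ A k := by
  constructor
  · rintro ⟨k, hk, hγk⟩
    obtain ⟨j, hj, hmax⟩ := Finset.exists_max_image
      (Finset.univ.filter fun j : Fin d => γ < c / x j ^ α) id ⟨k, by simpa using hγk⟩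
    simp only [Finset.mem_filter, Finset.mem_univ, true_and, id] at hj hmax
    refine ⟨j, ⟨?_, hj.trans_le (le_tailLevel hα hc hx le_rfl)⟩, hA (hmax k hγk) hk⟩
    by_cases hd : (j : ℕ) + 1 < d
    · obtain ⟨i, hi, h⟩ := exists_tailLevel_eq α c x hd
      rw [h]
      by_contra! hlt
      have := Fin.le_def.1 (hmax i hlt)
      omega
    -- At the last index the next level is the default `0`, which is where `0 < γ` enters.
    · rw [tailLevel, dif_neg hd]
      exact hγ.le
  · rintro ⟨k, hk, hy⟩
    obtain ⟨j, hj, h⟩ := exists_tailLevel_eq α c x k.2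
    exact ⟨j, hA hj hy, h ▸ hk.2⟩

end tailLevel

/-! ### Suprema of Poisson points over nested sets -/

lemma prod_iUnion_Ico_tailLevel {S : Type*} [MeasurableSpace S] {ν : Measure S} [SFinite ν]
    {α : ℝ} (hα : 0 < α) (c : ℝ≥0) {d : ℕ} {x : Fin d → ℝ} (hx : ∀ k, 0 < x k)
    {A : Fin d → Set S} (hAm : ∀ k, MeasurableSet (A k)) (hν : ∀ k, ν (A k) ≠ ∞) :
    (((volume : Measure ℝ).restrict (Ioi 0)).prod ν)
        (⋃ k : Fin d, Ico (tailLevel α c x (k + 1)) (tailLevel α c x k) ×ˢ A k) =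
      ENNReal.ofReal (∑ k, extremalWeight α x k * (c * (ν (A k)).toReal)) := by
  have hanti := antitone_tailLevel hα c.coe_nonneg hx
  have hw : ∀ k : Fin d, 0 ≤ c * extremalWeight α x k := fun k => by
    rw [← tailLevel_sub_tailLevel]
    exact sub_nonneg.2 (hanti (Nat.le_succ _))
  rw [measure_iUnion, tsum_fintype, ENNReal.ofReal_sum_of_nonneg]
  · refine Finset.sum_congr rfl fun k _ => ?_
    -- The lowest strip `[0, s)` contains `0`, which `Ioi 0` omits; passing to `Ici 0` changes only
    -- a null set.
    rw [Measure.prod_prod, Measure.restrict_congr_set Ioi_ae_eq_Ici,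
      Measure.restrict_apply measurableSet_Ico, inter_eq_self_of_subset_left,
      Real.volume_Ico, tailLevel_sub_tailLevel]
    · rw [← mul_assoc, mul_comm _ (c : ℝ), ENNReal.ofReal_mul (hw k), ENNReal.ofReal_toReal (hν k)]
    · exact fun y hy => (tailLevel_nonneg c.coe_nonneg hx _).trans hy.1
  · intro k _
    rw [← mul_assoc, mul_comm _ (c : ℝ)]
    exact mul_nonneg (hw k) ENNReal.toReal_nonneg
  · intro i j hij
    refine Disjoint.set_prod_left ?_ _ _
    exact hanti.pairwise_disjoint_on_Ico_succ (fun h => hij (Fin.ext h))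
  · exact fun k => measurableSet_Ico.prod (hAm k)

lemma IsPoissonEnumeration.ae_pos {Ω S : Type*} [MeasurableSpace Ω] [MeasurableSpace S]
    {ν : Measure S} [SFinite ν] {P : Measure Ω} [IsProbabilityMeasure P] {Γ : ℕ → Ω → ℝ}
    {Y : ℕ → Ω → S}
    (h : IsPoissonEnumeration (fun ℓ ω => (Γ ℓ ω, Y ℓ ω))
      (((volume : Measure ℝ).restrict (Ioi 0)).prod ν) P) :
    ∀ᵐ ω ∂P, ∀ ℓ, 0 < Γ ℓ ω := by
  have h1 := h.ae_forall_notMem (B := Iic 0 ×ˢ univ) (measurableSet_Iic.prod .univ) (by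
    rw [Measure.prod_prod, Measure.restrict_apply measurableSet_Iic, Iic_inter_Ioi]
    simp)
  filter_upwards [h1] with ω hω ℓ
  simpa using hω ℓ

lemma IsPoissonEnumeration.measure_forall_iSup_le {Ω S : Type*} [MeasurableSpace Ω]
    [MeasurableSpace S] {ν : Measure S} [SFinite ν] {P : Measure Ω} [IsProbabilityMeasure P]
    {Γ : ℕ → Ω → ℝ} {Y : ℕ → Ω → S}
    (h : IsPoissonEnumeration (fun ℓ ω => (Γ ℓ ω, Y ℓ ω))
      (((volume : Measure ℝ).restrict (Ioi 0)).prod ν) P)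
    {α : ℝ} (hα : 0 < α) (c : ℝ≥0) {d : ℕ} {x : Fin d → ℝ} (hx : ∀ k, 0 < x k)
    {A : Fin d → Set S} (hA : Monotone A) (hAm : ∀ k, MeasurableSet (A k))
    (hν : ∀ k, ν (A k) ≠ ∞) :
    P {ω | ∀ k, ((c ^ (1 / α) : ℝ≥0) : ℝ≥0∞) *
        ⨆ ℓ, (A k).indicator (fun _ => frechetWeight α (Γ ℓ ω)) (Y ℓ ω) ≤ ENNReal.ofReal (x k)} =
      ENNReal.ofReal (Real.exp (-∑ k, extremalWeight α x k * (c * (ν (A k)).toReal))) := by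
  have hμ := prod_iUnion_Ico_tailLevel hα c hx hAm hν
  have hnn : 0 ≤ ∑ k, extremalWeight α x k * (c * (ν (A k)).toReal) :=
    Finset.sum_nonneg fun k _ => by
      rw [← mul_assoc, mul_comm _ (c : ℝ), ← tailLevel_sub_tailLevel]
      exact mul_nonneg (sub_nonneg.2 (antitone_tailLevel hα c.coe_nonneg hx (Nat.le_succ _)))
        ENNReal.toReal_nonneg
  have hvoid := h.measure_forall_notMem
    (MeasurableSet.iUnion fun k => measurableSet_Ico.prod (hAm k))
    (hμ ▸ ENNReal.ofReal_ne_top)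
  rw [hμ, ENNReal.toReal_ofReal hnn] at hvoid
  rw [← hvoid]
  refine measure_congr ?_
  filter_upwards [h.ae_pos] with ω hω
  refine propext ?_
  change (∀ k, _) ↔ ∀ ℓ, _
  have h1 : ∀ ℓ, (Γ ℓ ω, Y ℓ ω) ∉
      (⋃ k : Fin d, Ico (tailLevel α c x (k + 1)) (tailLevel α c x k) ×ˢ A k) ↔
      ∀ k, Y ℓ ω ∈ A k → c / x k ^ α ≤ Γ ℓ ω := fun ℓ => by
    have := exists_lt_iff_exists_mem_Ico hα c.coe_nonneg hx hA (hω ℓ) (Y ℓ ω)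
    rw [Set.mem_iUnion]
    simp only [Set.mem_prod]
    rw [← this]
    push Not
    rfl
  simp_rw [h1, ENNReal.mul_iSup, iSup_le_iff]
  rw [forall_comm]
  refine forall_congr' fun ℓ => forall_congr' fun k => ?_
  by_cases hy : Y ℓ ω ∈ A k
  · simp only [Set.indicator_of_mem hy, hy, true_imp_iff]
    exact mul_frechetWeight_le_iff hα (hω ℓ) c (hx k)
  · simp [hy]

/-! ### Values of Choquet sup-measures at compact sets -/

/-- A nonempty closed set meets some member of a compact covering, and the empty set is `ν`-null.
This gives the product intensity its usual formula on rectangles. -/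
lemma sigmaFinite_of_hitSet {E : Type*} [TopologicalSpace E] [SigmaCompactSpace E]
    {ν : Measure (Closeds E)} (h0 : ν {⊥} = 0)
    (hν : ∀ K : Set E, IsCompact K → ν (hitSet K) ≠ ∞) : SigmaFinite ν := by
  refine ⟨⟨⟨fun n => {⊥} ∪ hitSet (compactCovering E n), fun _ => trivial, fun n => ?_, ?_⟩⟩⟩
  · exact (measure_union_le _ _).trans_lt
      (by simpa [h0] using (hν _ (isCompact_compactCovering E n)).lt_top)
  · refine Set.eq_univ_of_forall fun F => Set.mem_iUnion.2 ?_
    by_cases hF : F = ⊥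
    · exact ⟨0, Or.inl hF⟩
    · have : (F : Set E).Nonempty := by
        rw [Set.nonempty_iff_ne_empty]
        exact fun h => hF (Closeds.ext h)
      obtain ⟨y, hy⟩ := this
      obtain ⟨n, hn⟩ := exists_mem_compactCovering y
      exact ⟨n, Or.inr ⟨y, hy, hn⟩⟩

lemma frechetWeight_le_of_le {α : ℝ} (hα : 0 < α) {γ ε : ℝ} (hγ : 0 < γ) (hε : 0 < ε)
    (h : 1 / ε ^ α ≤ γ) : frechetWeight α γ ≤ ENNReal.ofReal ε := by
  simpa using (mul_frechetWeight_le_iff hα hγ 1 hε).2 (by simpa using h)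

/-- An open set slightly larger than `K` may be hit by further points, but only finitely many with
`Γ < n` meet the neighbourhood `K'`. Removing the corresponding closed sets that miss `K` leaves an
open set around `K` whose only new contributions have arbitrarily small weight. -/
lemma SupMeasure.extend_ofPoints {E : Type*} [TopologicalSpace E]
    {α : ℝ} (hα : 0 < α) {Γ : ℕ → ℝ} (hΓ : ∀ ℓ, 0 < Γ ℓ) {R : ℕ → Closeds E} {K K' : Set E}
    (hKK' : K ⊆ interior K')
    (hfin : ∀ n : ℕ, {ℓ | Γ ℓ < n ∧ R ℓ ∈ hitSet K'}.Finite) :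
    (SupMeasure.ofPoints (fun ℓ => frechetWeight α (Γ ℓ)) R).extend K =
      ⨆ ℓ, (hitSet K).indicator (fun _ => frechetWeight α (Γ ℓ)) (R ℓ) := by
  apply le_antisymm
  · refine le_of_forall_gt_imp_ge_of_dense fun y hy => ?_
    obtain ⟨ε, hε, hεy⟩ : ∃ ε : ℝ, 0 < ε ∧ ENNReal.ofReal ε ≤ y := by
      obtain ⟨r, hr0, hr⟩ := ENNReal.lt_iff_exists_real_btwn.1 (zero_le.trans_lt hy)
      exact ⟨r, by simpa using hr.1, hr.2.le⟩
    -- With this `n`, any point with `Γ ≥ n` has weight at most `ε ≤ y` and need not be removed.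
    obtain ⟨n, hn⟩ := exists_nat_ge (1 / ε ^ α)
    let T := {ℓ | (Γ ℓ < n ∧ R ℓ ∈ hitSet K') ∧ R ℓ ∉ hitSet K}
    have hT : T.Finite := (hfin n).subset fun _ h => h.1
    let G : Opens E := ⟨interior K' ∩ ⋂ ℓ ∈ T, ((R ℓ : Set E))ᶜ, isOpen_interior.inter
      (hT.isOpen_biInter fun ℓ _ => (R ℓ).isClosed.isOpen_compl)⟩
    have hKG : K ⊆ (G : Set E) := fun z hz => ⟨hKK' hz, Set.mem_iInter₂.2 fun ℓ hℓ hzR =>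
      hℓ.2 ⟨z, hzR, hz⟩⟩
    refine (iInf₂_le G hKG).trans (iSup_le fun ℓ => ?_)
    by_cases hG : R ℓ ∈ hitSet (G : Set E)
    · rw [Set.indicator_of_mem hG]
      obtain ⟨z, hzR, hzG⟩ := hG
      by_cases hK : R ℓ ∈ hitSet K
      · refine le_trans ?_ hy.le
        refine le_iSup_of_le ℓ ?_
        rw [Set.indicator_of_mem hK]
      · have hℓ : ¬ Γ ℓ < n := fun hlt =>
          Set.mem_iInter₂.1 hzG.2 ℓ ⟨⟨hlt, z, hzR, interior_subset hzG.1⟩, hK⟩ hzR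
        exact (frechetWeight_le_of_le hα (hΓ ℓ) hε (hn.trans (not_lt.1 hℓ))).trans hεy
    · rw [Set.indicator_of_notMem hG]
      exact zero_le
  · refine le_iInf₂ fun G hG => iSup_mono fun ℓ => ?_
    refine indicator_le_indicator_of_subset ?_ (fun _ => zero_le) _
    rintro F ⟨z, hzF, hz⟩
    exact ⟨z, hzF, hG hz⟩

theorem IsChoquetFrechet.measure_forall_extend_le {E Ω : Type*} [TopologicalSpace E]
    [LocallyCompactSpace E] [SigmaCompactSpace E] [MeasurableSpace Ω] {P : Measure Ω} {α : ℝ}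
    (hα : 0 < α) {θ : Set E → ℝ≥0} {M : Ω → SupMeasure E} (hC : IsChoquetFrechet α θ M P) {d : ℕ}
    {K : Fin d → Set E} (hK : ∀ k, IsCompact (K k)) (hmono : Monotone K) {x : Fin d → ℝ}
    (hx : ∀ k, 0 < x k) :
    P {ω | ∀ k, (M ω).extend (K k) ≤ ENNReal.ofReal (x k)} =
      ENNReal.ofReal (Real.exp (-∑ k, extremalWeight α x k * (θ (K k) : ℝ))) := by
  obtain ⟨ν, h0, hν, Ω', _, P', Γ, R, _, hX, hM⟩ := hC
  have hfinν : ∀ K : Set E, IsCompact K → ν (hitSet K) ≠ ∞ := fun K hK => by simp [hν K hK]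
  have := sigmaFinite_of_hitSet h0 hfinν
  have hset : MeasurableSet
      {m : SupMeasure E | ∀ k, m.extend (K k) ≤ ENNReal.ofReal (x k)} := by
    rw [Set.ofPred_forall]
    exact MeasurableSet.iInter fun k => SupMeasure.measurable_extend (hK k) measurableSet_Iic
  have h1 := hM.measure_mem_eq hset
  have h2 := hX.measure_forall_iSup_le hα 1 hx (A := fun k => hitSet (K k))
    (fun i j hij F ⟨z, hz, hzK⟩ => ⟨z, hz, hmono hij hzK⟩)
    (fun k => measurableSet_hitSet (hK k)) (fun k => hfinν _ (hK k))
  simp only [NNReal.one_rpow, ENNReal.coe_one, one_mul, NNReal.coe_one, hν _ (hK _),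
    ENNReal.coe_toReal] at h2
  rw [← h2]
  refine h1.trans (measure_congr ?_)
  -- Hits of the compact neighbourhoods `K' k` with `Γ < n` have finite intensity, so almost surely
  -- `extend_ofPoints` applies to every `K k`.
  choose K' hK'c hK' using fun k => exists_compact_superset (hK k)
  have h3 : ∀ᵐ ω ∂P', ∀ k, ∀ n : ℕ, {ℓ | Γ ℓ ω < n ∧ R ℓ ω ∈ hitSet (K' k)}.Finite := by
    rw [ae_all_iff]
    refine fun k => ae_all_iff.2 fun n => ?_
    refine hX.ae_finite (B := Iio (n : ℝ) ×ˢ hitSet (K' k))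
      (measurableSet_Iio.prod (measurableSet_hitSet (hK'c k))) ?_
    rw [Measure.prod_prod, Measure.restrict_apply measurableSet_Iio]
    refine ENNReal.mul_ne_top ?_ (hfinν _ (hK'c k))
    rw [inter_comm, Ioi_inter_Iio]
    simp
  filter_upwards [hX.ae_pos, h3] with ω hω hf
  refine propext ?_
  change (∀ k, _) ↔ ∀ k, _
  refine forall_congr' fun k => ?_
  rw [SupMeasure.extend_ofPoints hα hω (hK' k) (hf k)]

/-! ### Initial intervals and dilations -/

lemma isCompact_initialInterval {E : Set ℝ} (hE : IsClosed E) (t : ℝ) :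
    IsCompact (initialInterval E t) :=
  hE.isClosedEmbedding_subtypeVal.isCompact_preimage isCompact_Icc

lemma initialInterval_mono (E : Set ℝ) : Monotone (initialInterval E) :=
  fun _ _ h _ hx => ⟨hx.1, hx.2.trans h⟩

lemma SupMeasure.extend_scale {E : Type*} [TopologicalSpace E] {c : ℝ≥0} (hc : c ≠ 0)
    (m : SupMeasure E) (A : Set E) : (m.scale c).extend A = c * m.extend A := by
  simp only [extend, scale]
  rw [ENNReal.mul_iInf_of_ne (by simpa using hc) ENNReal.coe_ne_top]
  refine iInf_congr fun G => ?_
  rw [ENNReal.mul_iInf_of_ne (by simpa using hc) ENNReal.coe_ne_top]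

lemma SupMeasure.extend_dilate {E : Set ℝ} {c : ℝ≥0} (hE : ∀ y ∈ E, (c : ℝ) * y ∈ E)
    (m : SupMeasure E) (A : Set E) :
    (m.dilate c).extend A = m.extend {x | ∃ y ∈ A, (x : ℝ) = c * y} := by
  apply le_antisymm
  · refine le_iInf₂ fun G' hG' => ?_
    -- The preimage under multiplication by `c` of an open set covering the image of `A` is an open
    -- set covering `A`.
    let f : E → E := fun y => ⟨c * y, hE y y.2⟩
    have hf : Continuous f := by fun_prop
    refine (iInf₂_le (⟨f ⁻¹' G', G'.isOpen.preimage hf⟩ : Opens E) ?_).trans ?_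
    · exact fun y hy => hG' ⟨y, hy, rfl⟩
    · change m.extend _ ≤ _
      rw [← m.extend_coe G']
      refine m.extend_mono ?_
      rintro x ⟨y, hy, hxy⟩
      have : x = f y := Subtype.ext hxy
      rw [this]
      exact hy
  · refine le_iInf₂ fun G hG => m.extend_mono ?_
    rintro x ⟨y, hy, hxy⟩
    exact ⟨y, hG hy, hxy⟩

lemma SupMeasure.extend_dilate_initialInterval {E : Set ℝ}
    (hE : ∀ c : ℝ, 0 ≤ c → ∀ y ∈ E, c * y ∈ E) {c : ℝ≥0} (hc : 0 < c) (m : SupMeasure E) (t : ℝ) :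
    (m.dilate c).extend (initialInterval E t) = m.extend (initialInterval E (c * t)) := by
  rw [extend_dilate (hE c c.2)]
  congr 1
  have hc' : (0 : ℝ) < c := hc
  ext x
  constructor
  · rintro ⟨y, hy, hxy⟩
    refine ⟨?_, ?_⟩
    · rw [hxy]; exact mul_nonneg hc'.le hy.1
    · rw [hxy]; exact mul_le_mul_of_nonneg_left hy.2 hc'.le
  · intro hx
    refine ⟨⟨(c : ℝ)⁻¹ * x, hE _ (inv_nonneg.2 hc'.le) x x.2⟩, ⟨?_, ?_⟩, ?_⟩
    · exact mul_nonneg (inv_nonneg.2 hc'.le) hx.1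
    · rw [inv_mul_le_iff₀ hc']; exact hx.2
    · exact (mul_inv_cancel_left₀ hc'.ne' _).symm

/-! ### Self-similarity -/

lemma IsChoquetFrechet.measure_extend_le {E Ω : Type*} [TopologicalSpace E]
    [LocallyCompactSpace E] [SigmaCompactSpace E] [MeasurableSpace Ω] {P : Measure Ω} {α : ℝ}
    (hα : 0 < α) {θ : Set E → ℝ≥0} {M : Ω → SupMeasure E} (hC : IsChoquetFrechet α θ M P)
    {K : Set E} (hK : IsCompact K) {x : ℝ} (hx : 0 < x) :
    P {ω | (M ω).extend K ≤ ENNReal.ofReal x} =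
      ENNReal.ofReal (Real.exp (-(1 / x ^ α * (θ K : ℝ)))) := by
  have h := hC.measure_forall_extend_le hα (d := 1) (K := fun _ => K) (fun _ => hK)
    monotone_const (x := fun _ => x) (fun _ => hx)
  simpa [extremalWeight] using h

section SelfSimilar

variable {E : Set ℝ} {Ω : Type*} [MeasurableSpace Ω] {P : Measure Ω} {α H : ℝ}
  {θ : Set E → ℝ≥0} {M : Ω → SupMeasure E}

/-- Both sides of self-similarity are tested on the event that `[0,t]` has value at most `1`. The
probabilities are exponentials with exponents `-θ([0,ct])` and `-c^(αH) θ([0,t])`, and `exp` is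
injective. -/
lemma IsSelfSimilar.theta_initialInterval_mul (hE : IsClosed E)
    (hEc : ∀ c : ℝ, 0 ≤ c → ∀ y ∈ E, c * y ∈ E) (hα : 0 < α) (hC : IsChoquetFrechet α θ M P)
    (hS : IsSelfSimilar H M P) {c : ℝ≥0} (hc : 0 < c) {t : ℝ} :
    (θ (initialInterval E (c * t)) : ℝ) = c ^ (α * H) * θ (initialInterval E t) := by
  have := hE.isClosedEmbedding_subtypeVal.locallyCompactSpace
  have hc' : (0 : ℝ) < c := hc
  have hcH : 0 < c ^ H := NNReal.rpow_pos hc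
  have h1 := (hS c hc).measure_mem_eq
    (SupMeasure.measurable_extend (isCompact_initialInterval hE t)
      (measurableSet_Iic (a := ENNReal.ofReal 1)))
  have hl : P ((fun ω => (M ω).dilate c) ⁻¹'
      ((fun m : SupMeasure E => m.extend (initialInterval E t)) ⁻¹' Iic (ENNReal.ofReal 1))) =
      P {ω | (M ω).extend (initialInterval E (c * t)) ≤ ENNReal.ofReal 1} := by
    simp only [← SupMeasure.extend_dilate_initialInterval hEc hc]
    rfl
  have hr : P ((fun ω => (M ω).scale ((c ^ H : ℝ≥0) : ℝ≥0∞)) ⁻¹'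
      ((fun m : SupMeasure E => m.extend (initialInterval E t)) ⁻¹' Iic (ENNReal.ofReal 1))) =
      P {ω | (M ω).extend (initialInterval E t) ≤ ENNReal.ofReal (((c : ℝ) ^ H)⁻¹)} := by
    congr 1
    ext ω
    change ((M ω).scale ((c ^ H : ℝ≥0) : ℝ≥0∞)).extend (initialInterval E t) ≤ ENNReal.ofReal 1 ↔
      (M ω).extend (initialInterval E t) ≤ ENNReal.ofReal (((c : ℝ) ^ H)⁻¹)
    rw [SupMeasure.extend_scale hcH.ne', mul_comm,
      ← ENNReal.le_div_iff_mul_le (Or.inl (by simpa using hcH.ne')) (Or.inl ENNReal.coe_ne_top),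
      ENNReal.ofReal_inv_of_pos (by positivity), ENNReal.ofReal_one, one_div,
      ← NNReal.coe_rpow, ENNReal.ofReal_coe_nnreal]
  rw [hl, hr, hC.measure_extend_le hα (isCompact_initialInterval hE _) one_pos,
    hC.measure_extend_le hα (isCompact_initialInterval hE _) (by positivity),
    ENNReal.ofReal_eq_ofReal_iff (Real.exp_pos _).le (Real.exp_pos _).le] at h1
  have h2 := neg_injective (Real.exp_injective h1)
  rw [Real.one_rpow, div_one, one_mul, Real.inv_rpow (by positivity), one_div, inv_inv,
    ← Real.rpow_mul hc'.le, mul_comm H α] at h2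
  exact h2

lemma IsSelfSimilar.theta_initialInterval (hE : IsClosed E)
    (hEc : ∀ c : ℝ, 0 ≤ c → ∀ y ∈ E, c * y ∈ E) (hα : 0 < α) (hH : 0 < H)
    (hC : IsChoquetFrechet α θ M P) (hS : IsSelfSimilar H M P) (t : ℝ≥0) :
    (θ (initialInterval E t) : ℝ) = θ (initialInterval E 1) * (t : ℝ) ^ (α * H) := by
  have hαH : 0 < α * H := mul_pos hα hH
  rcases eq_or_ne t 0 with rfl | ht
  -- Scaling fixes `{0}`, so `θ({0}) = 2^(αH) θ({0})` with `2^(αH) > 1`, which forces `θ({0}) = 0`.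
  · have h := hS.theta_initialInterval_mul hE hEc hα hC (c := 2) two_pos (t := 0)
    have h2 : (1 : ℝ) < 2 ^ (α * H) := Real.one_lt_rpow one_lt_two hαH
    rw [mul_zero] at h
    rw [NNReal.coe_zero, Real.zero_rpow hαH.ne', mul_zero]
    have h3 : (2 ^ (α * H) - 1) * (θ (initialInterval E 0) : ℝ) = 0 := by
      have h4 : ((2 : ℝ≥0) : ℝ) = 2 := rfl
      rw [h4] at h
      linarith
    exact (mul_eq_zero.1 h3).resolve_left (by linarith)
  · have h := hS.theta_initialInterval_mul hE hEc hα hC (pos_iff_ne_zero.2 ht) (t := 1)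
    rw [mul_one] at h
    rw [h, mul_comm]

end SelfSimilar

/-! ### Laws of processes -/

/-- The events that a process with values in `[0, ∞]` is bounded by positive reals at finitely
many times. -/
def boundedEvents (T : Type*) : Set (Set (T → ℝ≥0∞)) :=
  {S | ∃ L : Finset (T × ℝ), (∀ p ∈ L, 0 < p.2) ∧
    S = {f | ∀ p ∈ L, f p.1 ≤ ENNReal.ofReal p.2}}

lemma isPiSystem_boundedEvents (T : Type*) : IsPiSystem (boundedEvents T) := by
  classical
  rintro _ ⟨L, hL, rfl⟩ _ ⟨L', hL', rfl⟩ -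
  refine ⟨L ∪ L', fun p hp => (Finset.mem_union.1 hp).elim (hL p) (hL' p), ?_⟩
  ext f
  simp only [mem_inter_iff, mem_ofPred_eq, Finset.mem_union, or_imp, forall_and]

/-- The distribution formulas cover only positive finite bounds. A bound `a < ∞`, including `a = 0`,
is the limit of `a + 1/(n+1)`, and the bound `∞` is vacuous. -/
lemma generateFrom_boundedEvents (T : Type*) :
    (MeasurableSpace.pi : MeasurableSpace (T → ℝ≥0∞)) =
      MeasurableSpace.generateFrom (boundedEvents T) := by
  apply le_antisymm
  · refine iSup_le fun t => ?_
    rw [← measurable_iff_comap_le]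
    let := MeasurableSpace.generateFrom (boundedEvents T)
    refine measurable_of_Iic fun a => ?_
    rcases eq_or_ne a ∞ with rfl | ha
    · simp
    · have h1 : (fun f : T → ℝ≥0∞ => f t) ⁻¹' Iic a =
          ⋂ n : ℕ, {f | f t ≤ ENNReal.ofReal (a.toReal + 1 / (n + 1))} := by
        ext f
        simp only [mem_preimage, mem_Iic, mem_iInter, mem_ofPred_eq]
        constructor
        · intro h n
          rw [← ENNReal.ofReal_toReal ha] at h
          refine h.trans (ENNReal.ofReal_le_ofReal ?_)
          have : (0 : ℝ) < 1 / (n + 1) := by positivity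
          linarith
        · intro h
          have h2 := (ENNReal.continuous_ofReal.tendsto (a.toReal + 0)).comp
            (tendsto_one_div_add_atTop_nhds_zero_nat.const_add a.toReal)
          rw [add_zero, ENNReal.ofReal_toReal ha] at h2
          exact ge_of_tendsto' h2 h
      rw [h1]
      refine MeasurableSet.iInter fun n => ?_
      refine MeasurableSpace.measurableSet_generateFrom
        ⟨{(t, a.toReal + 1 / (n + 1))}, ?_, ?_⟩
      · have := ENNReal.toReal_nonneg (a := a)
        simp only [Finset.mem_singleton, forall_eq]
        positivity
      · simp
  · refine MeasurableSpace.generateFrom_le ?_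
    rintro _ ⟨L, -, rfl⟩
    have : {f : T → ℝ≥0∞ | ∀ p ∈ L, f p.1 ≤ ENNReal.ofReal p.2} =
        ⋂ p ∈ L, {f | f p.1 ≤ ENNReal.ofReal p.2} := by
      ext f; simp
    rw [this]
    exact Finset.measurableSet_biInter _ fun p _ => measurable_pi_apply p.1 measurableSet_Iic

lemma identDistrib_of_forall_monotone {T Ω Ω' : Type*} [LinearOrder T] [MeasurableSpace Ω]
    [MeasurableSpace Ω'] {P : Measure Ω} {P' : Measure Ω'} [IsProbabilityMeasure P]
    [IsProbabilityMeasure P'] {X : Ω → T → ℝ≥0∞} {Y : Ω' → T → ℝ≥0∞} (hX : Measurable X)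
    (hY : Measurable Y)
    (h : ∀ (d : ℕ) (t : Fin d → T) (x : Fin d → ℝ), Monotone t → (∀ k, 0 < x k) →
      P {ω | ∀ k, X ω (t k) ≤ ENNReal.ofReal (x k)} =
        P' {ω | ∀ k, Y ω (t k) ≤ ENNReal.ofReal (x k)}) :
    IdentDistrib X Y P P' := by
  refine ⟨hX.aemeasurable, hY.aemeasurable, ?_⟩
  have := Measure.isProbabilityMeasure_map (μ := P) hX.aemeasurable
  have := Measure.isProbabilityMeasure_map (μ := P') hY.aemeasurable
  refine ext_of_generate_finite _ (generateFrom_boundedEvents T) (isPiSystem_boundedEvents T)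
    ?_ (by simp)
  intro S hS
  have hSm : MeasurableSet S := by
    rw [generateFrom_boundedEvents T]
    exact MeasurableSpace.measurableSet_generateFrom hS
  rw [Measure.map_apply hX hSm, Measure.map_apply hY hSm]
  obtain ⟨L, hL, rfl⟩ := hS
  -- Sorting the constraints lexicographically lists the times in increasing order. A time may occur
  -- with several bounds, so the list is only monotone, not strictly so.
  let L' : Finset (T ×ₗ ℝ) := L.map toLex.toEmbedding
  let e := L'.orderIsoOfFin rfl
  have he : ∀ k, ofLex (e k : T ×ₗ ℝ) ∈ L := fun k => by
    obtain ⟨p, hp, hpe⟩ := Finset.mem_map.1 (e k).2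
    rw [← hpe]
    exact hp
  have hfor : ∀ f : T → ℝ≥0∞, (∀ p ∈ L, f p.1 ≤ ENNReal.ofReal p.2) ↔
      ∀ k, f (ofLex (e k : T ×ₗ ℝ)).1 ≤ ENNReal.ofReal (ofLex (e k : T ×ₗ ℝ)).2 := fun f => by
    refine ⟨fun hf k => hf _ (he k), fun hf p hp => ?_⟩
    obtain ⟨k, hk⟩ := e.surjective ⟨toLex p, Finset.mem_map_of_mem _ hp⟩
    have := hf k
    rw [hk] at this
    exact this
  have h1 := h _ (fun k => (ofLex (e k : T ×ₗ ℝ)).1) (fun k => (ofLex (e k : T ×ₗ ℝ)).2)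
    (fun i j hij => Prod.Lex.monotone_fst _ _ (e.monotone hij)) (fun k => hL _ (he k))
  simp only [preimage_ofPred_eq, hfor]
  exact h1

lemma measurable_frechetWeight (α : ℝ) : Measurable (frechetWeight α) := by
  unfold frechetWeight
  fun_prop

lemma IsStandardExtremalProcess.measurable {Ω : Type*} [MeasurableSpace Ω] {P : Measure Ω} {α : ℝ}
    {Z : Ω → ℝ≥0 → ℝ≥0∞} (hZ : IsStandardExtremalProcess α Z P) (t : ℝ≥0) :
    Measurable fun ω => Z ω t := by
  obtain ⟨Γ, U, hX, hZ⟩ := hZ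
  simp only [hZ]
  refine Measurable.iSup fun ℓ => ?_
  have hΓ : Measurable (Γ ℓ) := (hX.measurable ℓ).fst
  have hU : Measurable (U ℓ) := (hX.measurable ℓ).snd
  have h1 : (fun ω => (Icc (0 : ℝ) t).indicator (fun _ => frechetWeight α (Γ ℓ ω)) (U ℓ ω)) =
      (U ℓ ⁻¹' Icc (0 : ℝ) t).indicator fun ω => frechetWeight α (Γ ℓ ω) := rfl
  rw [h1]
  exact ((measurable_frechetWeight α).comp hΓ).indicator (hU measurableSet_Icc)

/-- The same void computation, with Lebesgue measure on `[0,∞)` as `ν` and the nested sets `[0, t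
k]`. -/
lemma IsStandardExtremalProcess.measure_forall_mul_le {Ω : Type*} [MeasurableSpace Ω]
    {P : Measure Ω} [IsProbabilityMeasure P] {α : ℝ} (hα : 0 < α) {Z : Ω → ℝ≥0 → ℝ≥0∞}
    (hZ : IsStandardExtremalProcess α Z P) (c : ℝ≥0) {d : ℕ} {t : Fin d → ℝ≥0}
    (ht : Monotone t) {x : Fin d → ℝ} (hx : ∀ k, 0 < x k) :
    P {ω | ∀ k, ((c ^ (1 / α) : ℝ≥0) : ℝ≥0∞) * Z ω (t k) ≤ ENNReal.ofReal (x k)} =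
      ENNReal.ofReal (Real.exp (-∑ k, extremalWeight α x k * (c * (t k : ℝ)))) := by
  obtain ⟨Γ, U, hX, hZ⟩ := hZ
  have hvol : ∀ s : ℝ≥0, ((volume : Measure ℝ).restrict (Ici 0)) (Icc 0 (s : ℝ)) =
      ENNReal.ofReal s := fun s => by
    rw [Measure.restrict_apply measurableSet_Icc, inter_eq_self_of_subset_left fun y hy => hy.1,
      Real.volume_Icc, sub_zero]
  have h := hX.measure_forall_iSup_le hα c hx (A := fun k => Icc (0 : ℝ) (t k))
    (fun i j hij => Icc_subset_Icc_right (NNReal.coe_le_coe.2 (ht hij)))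
    (fun k => measurableSet_Icc) (fun k => by simp [hvol])
  simp only [hvol, ENNReal.toReal_ofReal (NNReal.coe_nonneg _)] at h
  simpa only [hZ] using h

theorem propositionA1 {E : Set ℝ} (hE : E = univ ∨ E = Ici 0)
    {Ω : Type*} [MeasurableSpace Ω] (P : Measure Ω) [IsProbabilityMeasure P]
    (α : ℝ) (hα : 0 < α) (θ : Set E → ℝ≥0)
    (M : Ω → SupMeasure E) (hM : Measurable M) (hC : IsChoquetFrechet α θ M P) :
    (∀ (d : ℕ) (t : Fin d → ℝ≥0) (x : Fin d → ℝ),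
      (∀ k, 0 < t k) → StrictMono t → (∀ k, 0 < x k) →
      P {ω | ∀ k, extremalProcess M ω (t k) ≤ ENNReal.ofReal (x k)} =
        ENNReal.ofReal (Real.exp
          (-∑ k, extremalWeight α x k * (θ (initialInterval E (t k)) : ℝ)))) ∧
    (∀ H : ℝ, 0 < H → IsSelfSimilar H M P →
      ∀ {Ω' : Type*} [MeasurableSpace Ω'] (P' : Measure Ω') [IsProbabilityMeasure P']
        (Z : Ω' → ℝ≥0 → ℝ≥0∞), IsStandardExtremalProcess α Z P' →
        IdentDistrib (extremalProcess M)
          (fun ω t => ((θ (initialInterval E 1) ^ (1 / α) : ℝ≥0) : ℝ≥0∞) * Z ω (t ^ (α * H)))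
          P P') := by
  have hcl : IsClosed E := by
    rcases hE with rfl | rfl
    · exact isClosed_univ
    · exact isClosed_Ici
  have hEc : ∀ c : ℝ, 0 ≤ c → ∀ y ∈ E, c * y ∈ E := by
    rcases hE with rfl | rfl
    · exact fun _ _ _ _ => mem_univ _
    · exact fun _ hc _ hy => mul_nonneg hc hy
  have := hcl.isClosedEmbedding_subtypeVal.locallyCompactSpace
  -- Repeated times and time `0` are allowed here, as the comparison of process laws in (ii) needs
  -- both.
  have hfdd : ∀ (d : ℕ) (t : Fin d → ℝ≥0) (x : Fin d → ℝ), Monotone t → (∀ k, 0 < x k) →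
      P {ω | ∀ k, extremalProcess M ω (t k) ≤ ENNReal.ofReal (x k)} =
        ENNReal.ofReal (Real.exp
          (-∑ k, extremalWeight α x k * (θ (initialInterval E (t k)) : ℝ))) :=
    fun d t x ht hx => hC.measure_forall_extend_le hα
      (fun k => isCompact_initialInterval hcl (t k))
      (fun i j hij => initialInterval_mono E (NNReal.coe_le_coe.2 (ht hij))) hx
  refine ⟨fun d t x _ ht hx => hfdd d t x ht.monotone hx, ?_⟩
  intro H hH hS Ω' _ P' _ Z hZ
  refine identDistrib_of_forall_monotone ?_ ?_ fun d t x ht hx => ?_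
  · exact measurable_pi_lambda _ fun t =>
      (SupMeasure.measurable_extend (isCompact_initialInterval hcl t)).comp hM
  · exact measurable_pi_lambda _ fun t => (hZ.measurable _).const_mul _
  · rw [hfdd d t x ht hx, hZ.measure_forall_mul_le hα _
      (fun i j hij => NNReal.rpow_le_rpow (ht hij) (mul_pos hα hH).le) hx]
    simp only [hS.theta_initialInterval hcl hEc hα hH hC, NNReal.coe_rpow]
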